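/- Let $n\ge 2$ and let $M$ be a smooth $n$-dimensional manifold, smoothly embedded as a hypersurface in $\mathbb R^{n+1}$ and equipped with the induced Riemannian metric $g$. Let $v$ be a smooth (tangent) vector field on $M$, let $p\in M$, and extend $v$ to a smooth vector field, still denoted $v$, on a neighborhood of $p$ in $\mathbb R^{n+1}$; the extension is otherwise arbitrary. Let $N$ be a smooth vector field on a neighborhood of $p$ in $\mathbb R^{n+1}$ which, at the points of $M$ in this neighborhood, is a unit normal to $M$. Then, with all terms evaluated at $p$, $$(\tilde\nabla^*\tilde\nabla v)^T=\nabla^*\nabla v-\operatorname{Ric}v+nH\,[N,v]^T-(\tilde\nabla_N\tilde\nabla_N v)^T+(\tilde\nabla_{\tilde\nabla_N N}v)^T .$$ No divergence-free assumption is made. Here $(\cdot)^T$ is the orthogonal projection of $\mathbb R^{n+1}$ onto $T_pM$; $\tilde\nabla$ is the Euclidean connection on $\mathbb R^{n+1}$ and $\nabla$ the Levi-Civita connection of $(M,g)$; $\tilde\nabla^*\tilde\nabla v=-\operatorname{div}\tilde\nabla v=-\sum_{\alpha=1}^{n+1}\partial_\alpha\partial_\alpha v$ and $\nabla^*\nabla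 v=-\operatorname{div}\nabla v=-\nabla^i\nabla_i v$ are the Bochner Laplacians; $\operatorname{Ric}v=(\operatorname{Ric}(v,\cdot))^\sharp$, where $\operatorname{Ric}$ is the Ricci tensor of $(M,g)$, with components $R_{jk}=R_{ijk}{}^{i}$ for $R(X,Y)Z=\nabla_X\nabla_YZ-\nabla_Y\nabla_XZ-\nabla_{[X,Y]}Z$ and $R(\partial_i,\partial_j)\partial_k=R_{ijk}{}^{l}\partial_l$; $[\cdot,\cdot]$ is the Lie bracket; and $H=\frac1n\operatorname{tr}s$ is the mean curvature, where the shape operator $s$ is defined by $g(sX,Y)=h(X,Y)=\langle N,\tilde\nabla_XY-\nabla_XY\rangle$ for $X,Y$ tangent to $M$. -/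

import Mathlib

open scoped Manifold ContDiff

noncomputable section

namespace Hypersurface

/-- The coordinate partial derivative `∂ᵢ f` of a function on `ℝᵐ`. -/
def pderiv {m : ℕ} {W : Type*} [NormedAddCommGroup W] [NormedSpace ℝ W] (i : Fin m)
    (f : EuclideanSpace ℝ (Fin m) → W) (y : EuclideanSpace ℝ (Fin m)) : W :=
  fderiv ℝ f y (EuclideanSpace.single i 1)

/-! ### Riemannian geometry in coordinates

A Riemannian metric on an open subset of `ℝⁿ` is given by its matrix of coefficients `g i j`,
a vector field by its components `v y j`. All formulas refer to the coordinate frame `∂ᵢ`. -/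

/-- Christoffel symbols `Γᵏᵢⱼ = ½ gᵏˡ (∂ᵢ gⱼₗ + ∂ⱼ gᵢₗ - ∂ₗ gᵢⱼ)` of the Levi-Civita connection of
the metric `g`, so that `∇_{∂ᵢ} ∂ⱼ = Γᵏᵢⱼ ∂ₖ`. -/
def christoffel {n : ℕ} (g : EuclideanSpace ℝ (Fin n) → Matrix (Fin n) (Fin n) ℝ)
    (k i j : Fin n) (y : EuclideanSpace ℝ (Fin n)) : ℝ :=
  (1 / 2 : ℝ) * ∑ l, (g y)⁻¹ k l *
    (pderiv i (fun z => g z j l) y + pderiv j (fun z => g z i l) y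
      - pderiv l (fun z => g z i j) y)

/-- Components `∇ᵢ vʲ = ∂ᵢ vʲ + Γʲᵢₖ vᵏ` of the covariant derivative `∇v`
(so `∇_X v` has components `Xⁱ ∇ᵢ vʲ`). -/
def nablaCoord {n : ℕ} (g : EuclideanSpace ℝ (Fin n) → Matrix (Fin n) (Fin n) ℝ)
    (v : EuclideanSpace ℝ (Fin n) → EuclideanSpace ℝ (Fin n))
    (i j : Fin n) (y : EuclideanSpace ℝ (Fin n)) : ℝ :=
  pderiv i (fun z => v z j) y + ∑ k, christoffel g j i k y * v y k

/-- Components `∇ₖ ∇ᵢ vʲ = ∂ₖ(∇ᵢ vʲ) + Γʲₖₗ ∇ᵢ vˡ - Γˡₖᵢ ∇ₗ vʲ` of the covariant derivative of the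
`(1,1)`-tensor field `∇v`. -/
def nablaNablaCoord {n : ℕ} (g : EuclideanSpace ℝ (Fin n) → Matrix (Fin n) (Fin n) ℝ)
    (v : EuclideanSpace ℝ (Fin n) → EuclideanSpace ℝ (Fin n))
    (k i j : Fin n) (y : EuclideanSpace ℝ (Fin n)) : ℝ :=
  pderiv k (nablaCoord g v i j) y
    + ∑ l, christoffel g j k l y * nablaCoord g v i l y
    - ∑ l, christoffel g l k i y * nablaCoord g v l j y

/-- Components `-∇ⁱ ∇ᵢ vʲ` of the Bochner Laplacian `∇*∇v = -div ∇v`. -/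
def bochnerCoord {n : ℕ} (g : EuclideanSpace ℝ (Fin n) → Matrix (Fin n) (Fin n) ℝ)
    (v : EuclideanSpace ℝ (Fin n) → EuclideanSpace ℝ (Fin n))
    (y : EuclideanSpace ℝ (Fin n)) : EuclideanSpace ℝ (Fin n) :=
  WithLp.toLp 2 fun j => -∑ i, ∑ k, (g y)⁻¹ i k * nablaNablaCoord g v k i j y

/-- Components `Rᵢⱼₖˡ` of the curvature `R(X,Y)Z = ∇_X ∇_Y Z - ∇_Y ∇_X Z - ∇_{[X,Y]} Z`, where
`R(∂ᵢ,∂ⱼ)∂ₖ = Rᵢⱼₖˡ ∂ₗ`. -/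
def curvatureCoord {n : ℕ} (g : EuclideanSpace ℝ (Fin n) → Matrix (Fin n) (Fin n) ℝ)
    (i j k l : Fin n) (y : EuclideanSpace ℝ (Fin n)) : ℝ :=
  pderiv i (christoffel g l j k) y - pderiv j (christoffel g l i k) y
    + ∑ m, (christoffel g m j k y * christoffel g l i m y
      - christoffel g m i k y * christoffel g l j m y)

/-- The Ricci tensor `Rⱼₖ = Rᵢⱼₖⁱ`. -/
def ricciCoord {n : ℕ} (g : EuclideanSpace ℝ (Fin n) → Matrix (Fin n) (Fin n) ℝ)
    (j k : Fin n) (y : EuclideanSpace ℝ (Fin n)) : ℝ :=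
  ∑ i, curvatureCoord g i j k i y

/-- Components `gⁱᵏ Rⱼₖ vʲ` of `Ric v = (Ric (v, ·))^♯`. -/
def ricciVecCoord {n : ℕ} (g : EuclideanSpace ℝ (Fin n) → Matrix (Fin n) (Fin n) ℝ)
    (v : EuclideanSpace ℝ (Fin n) → EuclideanSpace ℝ (Fin n))
    (y : EuclideanSpace ℝ (Fin n)) : EuclideanSpace ℝ (Fin n) :=
  WithLp.toLp 2 fun i => ∑ k, (g y)⁻¹ i k * ∑ j, ricciCoord g j k y * v y j

/-! ### The induced geometry of `ι : M → ℝⁿ⁺¹`, computed in a chart `e` of `M` -/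

section Manifold

variable {n : ℕ} {M : Type*} [TopologicalSpace M] [ChartedSpace (EuclideanSpace ℝ (Fin n)) M]

/-- Coefficients `⟨dι ∂ᵢ, dι ∂ⱼ⟩` in the chart `e` of the metric induced on `M` by `ι`. -/
def inducedMetric (ι : M → EuclideanSpace ℝ (Fin (n + 1)))
    (e : OpenPartialHomeomorph M (EuclideanSpace ℝ (Fin n)))
    (y : EuclideanSpace ℝ (Fin n)) : Matrix (Fin n) (Fin n) ℝ :=
  Matrix.of fun i j => inner ℝ (pderiv i (ι ∘ e.symm) y) (pderiv j (ι ∘ e.symm) y)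

/-- The components, in the chart `e`, of a vector field on `M`. -/
def components (e : OpenPartialHomeomorph M (EuclideanSpace ℝ (Fin n)))
    (V : ∀ x : M, TangentSpace (𝓡 n) x) (y : EuclideanSpace ℝ (Fin n)) :
    EuclideanSpace ℝ (Fin n) :=
  mfderiv (𝓡 n) (𝓡 n) e (e.symm y) (V (e.symm y))

/-- The tangent vector of `M` at `p` with components `w` in the chart `e`. -/
def ofComponents (e : OpenPartialHomeomorph M (EuclideanSpace ℝ (Fin n))) (p : M)
    (w : EuclideanSpace ℝ (Fin n)) : TangentSpace (𝓡 n) (e.symm (e p)) :=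
  mfderiv (𝓡 n) (𝓡 n) e.symm (e p) w

/-- `∇*∇V` at `p` for the Levi-Civita connection `∇` of the induced metric on `M`,
computed in the chart `e`. -/
def bochnerLaplacian (ι : M → EuclideanSpace ℝ (Fin (n + 1)))
    (e : OpenPartialHomeomorph M (EuclideanSpace ℝ (Fin n)))
    (V : ∀ x : M, TangentSpace (𝓡 n) x) (p : M) : TangentSpace (𝓡 n) p :=
  ofComponents e p (bochnerCoord (inducedMetric ι e) (components e V) (e p))

/-- `Ric V` at `p` for the induced metric on `M`, computed in the chart `e`. -/
def ricciVec (ι : M → EuclideanSpace ℝ (Fin (n + 1)))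
    (e : OpenPartialHomeomorph M (EuclideanSpace ℝ (Fin n)))
    (V : ∀ x : M, TangentSpace (𝓡 n) x) (p : M) : TangentSpace (𝓡 n) p :=
  ofComponents e p (ricciVecCoord (inducedMetric ι e) (components e V) (e p))

/-- The scalar second fundamental form `h(∂ᵢ,∂ⱼ) = ⟨N, ∇̃_{∂ᵢ} ∂ⱼ - ∇_{∂ᵢ} ∂ⱼ⟩` at `p`, in the
chart `e` and with respect to the normal field `N`. -/
def secondFundamentalForm (ι : M → EuclideanSpace ℝ (Fin (n + 1)))
    (e : OpenPartialHomeomorph M (EuclideanSpace ℝ (Fin n)))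
    (N : EuclideanSpace ℝ (Fin (n + 1)) → EuclideanSpace ℝ (Fin (n + 1))) (p : M) :
    Matrix (Fin n) (Fin n) ℝ :=
  Matrix.of fun i j => inner ℝ (N (ι p))
    (pderiv i (pderiv j (ι ∘ e.symm)) (e p)
      - ∑ k, christoffel (inducedMetric ι e) k i j (e p) • pderiv k (ι ∘ e.symm) (e p))

/-- The shape operator `s`, `g(sX, Y) = h(X, Y)`, as a matrix in the chart `e`:
`sⁱⱼ = gⁱᵏ hₖⱼ`. -/
def shapeOperator (ι : M → EuclideanSpace ℝ (Fin (n + 1)))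
    (e : OpenPartialHomeomorph M (EuclideanSpace ℝ (Fin n)))
    (N : EuclideanSpace ℝ (Fin (n + 1)) → EuclideanSpace ℝ (Fin (n + 1))) (p : M) :
    Matrix (Fin n) (Fin n) ℝ :=
  (inducedMetric ι e (e p))⁻¹ * secondFundamentalForm ι e N p

/-- The mean curvature `H`: the average of the principal curvatures, that is, `1/n` times the
trace of the shape operator. -/
def meanCurvature (ι : M → EuclideanSpace ℝ (Fin (n + 1)))
    (e : OpenPartialHomeomorph M (EuclideanSpace ℝ (Fin n)))
    (N : EuclideanSpace ℝ (Fin (n + 1)) → EuclideanSpace ℝ (Fin (n + 1))) (p : M) : ℝ :=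
  (1 / (n : ℝ)) * (shapeOperator ι e N p).trace

/-- `dι : T_pM → ℝⁿ⁺¹`. -/
def pushforward (ι : M → EuclideanSpace ℝ (Fin (n + 1))) (p : M) :
    TangentSpace (𝓡 n) p →L[ℝ] EuclideanSpace ℝ (Fin (n + 1)) :=
  mfderiv (𝓡 n) (𝓡 (n + 1)) ι p

/-- The orthogonal projection `w ↦ w^T` of `ℝⁿ⁺¹` onto the tangent space `dι(T_pM)`. -/
def tangentialPart (ι : M → EuclideanSpace ℝ (Fin (n + 1))) (p : M)
    (w : EuclideanSpace ℝ (Fin (n + 1))) : EuclideanSpace ℝ (Fin (n + 1)) :=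
  (LinearMap.range (pushforward ι p).toLinearMap).starProjection w

end Manifold

/-! ### The ambient Euclidean space -/

/-- The Euclidean connection `∇̃_X Y` on `ℝᵐ`. -/
def euclideanCov {m : ℕ} (X Y : EuclideanSpace ℝ (Fin m) → EuclideanSpace ℝ (Fin m))
    (x : EuclideanSpace ℝ (Fin m)) : EuclideanSpace ℝ (Fin m) :=
  fderiv ℝ Y x (X x)

/-- The Bochner Laplacian `∇̃*∇̃v = -div ∇̃v = -∑_α ∂_α ∂_α v` of the Euclidean connection. -/
def euclideanBochner {m : ℕ} (v : EuclideanSpace ℝ (Fin m) → EuclideanSpace ℝ (Fin m))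
    (x : EuclideanSpace ℝ (Fin m)) : EuclideanSpace ℝ (Fin m) :=
  -∑ α, pderiv α (pderiv α v) x

end Hypersurface

end

/-! Everything is computed in a chart, with X = `ι ∘ e.symm`, the frame ∂ᵢX completed by N, and the
dual frame, which reads off tangential components. Write D for the Euclidean derivative, h for the
second fundamental form and s for the shape operator. The Euclidean Laplacian is the trace of D²v,
which in the adapted frame is gⁱᵏ D²v(∂ₖ, ∂ᵢ) + D²v(N, N) (`sum_basis_eq_trace_frame`). Along M the
Gauss formula gives D_{∂ᵢ}v = ∇ᵢv + h(∂ᵢ, v) N (`fderiv_frame`). Differentiating once more and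
taking tangential parts, D²v(∂ₖ, ∂ᵢ)^T = ∇ₖ∇ᵢv - hₖᵢ (D_N v)^T - h(∂ᵢ, v) s∂ₖ
(`inner_dualFrame_hessian`). Tracing this, (∇̃*∇̃v)^T = ∇*∇v + nH (D_N v)^T + s²v - D²v(N, N)^T.
Three identities finish the proof. The contracted Gauss equation gives s²v = nH sv - Ric v
(`ricciVecCoord_eq`). Weingarten gives sv = -(D_v N)^T, so the nH terms combine to nH [N, v]^T. The
product rule gives D²v(N, N) = D_N D_N v - D_{D_N N} v. -/

noncomputable section

namespace Hypersurface

/-! ### Frames of a hyperplane and their dual frames -/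

section Frame

variable {n : ℕ} {F : Type*} [NormedAddCommGroup F] [InnerProductSpace ℝ F]

/-- The frame dual to `a` inside the span of `a`. -/
def dualFrame (a : Fin n → F) (i : Fin n) : F := ∑ j, (Matrix.gram ℝ a)⁻¹ i j • a j

theorem gram_inv_symm (a : Fin n → F) (i j : Fin n) :
    (Matrix.gram ℝ a)⁻¹ i j = (Matrix.gram ℝ a)⁻¹ j i := by
  have h : (Matrix.gram ℝ a).transpose = Matrix.gram ℝ a := by
    ext i j; simp [Matrix.gram_apply, real_inner_comm]
  rw [← Matrix.transpose_apply (Matrix.gram ℝ a)⁻¹, Matrix.transpose_nonsing_inv, h]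

theorem isUnit_det_gram {a : Fin n → F} (ha : LinearIndependent ℝ a) :
    IsUnit (Matrix.gram ℝ a).det :=
  (Matrix.det_gram_ne_zero_iff_linearIndependent.mpr ha).isUnit

theorem inner_dualFrame (a : Fin n → F) (i : Fin n) (u : F) :
    inner ℝ (dualFrame a i) u = ∑ j, (Matrix.gram ℝ a)⁻¹ i j * inner ℝ (a j) u := by
  simp [dualFrame, sum_inner, real_inner_smul_left]

theorem inner_dualFrame_frame {a : Fin n → F} (ha : LinearIndependent ℝ a) (i k : Fin n) :
    inner ℝ (dualFrame a i) (a k) = if i = k then 1 else 0 := by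
  rw [inner_dualFrame]
  have := congrFun (congrFun (Matrix.nonsing_inv_mul _ (isUnit_det_gram ha)) i) k
  rw [Matrix.mul_apply, Matrix.one_apply] at this
  simpa [Matrix.gram_apply] using this

theorem inner_dualFrame_normal {a : Fin n → F} {ν : F} (hν : ∀ i, inner ℝ ν (a i) = 0)
    (i : Fin n) : inner ℝ (dualFrame a i) ν = 0 := by
  rw [inner_dualFrame]
  exact Finset.sum_eq_zero fun j _ => by rw [real_inner_comm, hν, mul_zero]

theorem inner_dualFrame_sum {a : Fin n → F} (ha : LinearIndependent ℝ a) (i : Fin n)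
    (c : Fin n → ℝ) : inner ℝ (dualFrame a i) (∑ k, c k • a k) = c i := by
  simp [inner_sum, real_inner_smul_right, inner_dualFrame_frame ha]

/-- By dimension, the orthogonal complement of the span of `a` is the line through `ν`. -/
theorem eq_zero_of_inner_frame_eq_zero [Fact (Module.finrank ℝ F = n + 1)] {a : Fin n → F}
    (ha : LinearIndependent ℝ a) {ν : F} (hν1 : ‖ν‖ = 1) (hν : ∀ i, inner ℝ ν (a i) = 0) {u : F}
    (hu : ∀ i, inner ℝ u (a i) = 0) (huν : inner ℝ ν u = 0) : u = 0 := by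
  have hfd : FiniteDimensional ℝ F :=
    Module.finite_of_finrank_pos (by rw [Fact.out (p := Module.finrank ℝ F = n + 1)]; omega)
  set S := Submodule.span ℝ (Set.range a)
  have hS : Module.finrank ℝ S = n := by simpa using finrank_span_eq_card ha
  have hmem : ∀ w : F, (∀ i, inner ℝ w (a i) = 0) → w ∈ Sᗮ := by
    intro w hw
    rw [Submodule.mem_orthogonal]
    intro s hs
    induction hs using Submodule.span_induction with
    | mem x hx => obtain ⟨i, rfl⟩ := hx; rw [real_inner_comm, hw]
    | zero => simp
    | add x y _ _ hx hy => rw [inner_add_left, hx, hy, add_zero]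
    | smul c x _ hx => rw [real_inner_smul_left, hx, mul_zero]
  have hSo : Module.finrank ℝ Sᗮ = 1 := by
    have := S.finrank_add_finrank_orthogonal
    rw [hS, Fact.out (p := Module.finrank ℝ F = n + 1)] at this
    omega
  have hν0 : (⟨ν, hmem ν hν⟩ : Sᗮ) ≠ 0 := by
    intro h
    have : ν = 0 := congrArg Subtype.val h
    simp [this] at hν1
  obtain ⟨c, hc⟩ := (finrank_eq_one_iff_of_nonzero' _ hν0).mp hSo ⟨u, hmem u hu⟩
  have hc' : c • ν = u := congrArg Subtype.val hc
  rw [← hc', real_inner_smul_right, real_inner_self_eq_norm_sq, hν1] at huν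
  rw [← hc', show c = 0 by simpa using huν, zero_smul]

/-- The expansion of a vector in an adapted frame. -/
theorem eq_sum_dualFrame [Fact (Module.finrank ℝ F = n + 1)] {a : Fin n → F}
    (ha : LinearIndependent ℝ a) {ν : F} (hν1 : ‖ν‖ = 1) (hν : ∀ i, inner ℝ ν (a i) = 0) (u : F) :
    u = ∑ i, (inner ℝ (dualFrame a i) u : ℝ) • a i + (inner ℝ ν u : ℝ) • ν := by
  have hνν : (inner ℝ ν ν : ℝ) = 1 := by rw [real_inner_self_eq_norm_sq, hν1]; norm_num
  have key : ∀ j, inner ℝ (a j) (∑ i, (inner ℝ (dualFrame a i) u : ℝ) • a i) = inner ℝ (a j) u := by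
    intro j
    -- Pairing with `a j` contracts the Gram matrix against its inverse.
    have hm := Matrix.mul_nonsing_inv _ (isUnit_det_gram ha)
    simp only [inner_sum, real_inner_smul_right, inner_dualFrame, Finset.sum_mul]
    rw [Finset.sum_comm]
    have : ∀ k, ∑ i, (Matrix.gram ℝ a)⁻¹ i k * inner ℝ (a k) u * inner ℝ (a j) (a i)
        = (1 : Matrix (Fin n) (Fin n) ℝ) j k * inner ℝ (a k) u := by
      intro k
      rw [← hm, Matrix.mul_apply, Finset.sum_mul]
      refine Finset.sum_congr rfl fun i _ => ?_
      rw [Matrix.gram_apply]; ring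
    simp only [this, Matrix.one_apply]
    simp
  rw [← sub_eq_zero]
  refine eq_zero_of_inner_frame_eq_zero ha hν1 hν (fun j => ?_) ?_
  · rw [real_inner_comm, inner_sub_right, inner_add_right, key, real_inner_smul_right,
      real_inner_comm, real_inner_comm ν (a j), hν]
    simp
  · rw [inner_sub_right, inner_add_right, real_inner_smul_right, hνν, inner_sum]
    simp [real_inner_smul_right, hν]

/-- The trace of a bilinear map in an adapted frame. -/
theorem sum_basis_eq_trace_frame [Fact (Module.finrank ℝ F = n + 1)] {κ : Type*} [Fintype κ]
    (b : OrthonormalBasis κ ℝ F) {a : Fin n → F}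
    (ha : LinearIndependent ℝ a) {ν : F} (hν1 : ‖ν‖ = 1) (hν : ∀ i, inner ℝ ν (a i) = 0)
    {G : Type*} [NormedAddCommGroup G] [NormedSpace ℝ G] (B : F →L[ℝ] F →L[ℝ] G) :
    ∑ α, B (b α) (b α)
      = ∑ i, ∑ k, (Matrix.gram ℝ a)⁻¹ i k • B (a k) (a i) + B ν ν := by
  -- Only the first argument is expanded; its coefficients move to the second slot, where summing
  -- over the orthonormal basis reassembles the dual vectors and `ν`.
  have h1 : ∀ α, B (b α) (b α) = ∑ i, B (a i) ((inner ℝ (dualFrame a i) (b α) : ℝ) • b α)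
      + B ν ((inner ℝ ν (b α) : ℝ) • b α) := by
    intro α
    have h := congrArg (fun u => B u (b α)) (eq_sum_dualFrame ha hν1 hν (b α))
    simp only [map_add, map_sum, map_smul, add_apply,
      sum_apply, smul_apply] at h ⊢
    exact h
  simp only [h1, Finset.sum_add_distrib]
  rw [Finset.sum_comm]
  have h2 : ∀ u, ∑ α, (inner ℝ u (b α) : ℝ) • b α = u := by
    intro u
    conv_rhs => rw [← b.sum_repr' u]
    exact Finset.sum_congr rfl fun α _ => by rw [real_inner_comm]
  simp only [← map_sum, h2]
  rw [Finset.sum_comm]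
  congr 1
  refine Finset.sum_congr rfl fun i _ => ?_
  simp only [dualFrame, map_sum, map_smul]
  exact Finset.sum_congr rfl fun k _ => by rw [gram_inv_symm]

end Frame

/-! ### Coordinate partial derivatives -/

section PDeriv

open Topology

variable {m : ℕ} {W : Type*} [NormedAddCommGroup W] [NormedSpace ℝ W]
  {y : EuclideanSpace ℝ (Fin m)}

theorem _root_.ContDiffAt.pderiv {f : EuclideanSpace ℝ (Fin m) → W} (hf : ContDiffAt ℝ ∞ f y)
    (i : Fin m) : ContDiffAt ℝ ∞ (Hypersurface.pderiv i f) y :=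
  (hf.fderiv_right (m := ∞) le_rfl).clm_apply contDiffAt_const

theorem _root_.ContDiffAt.diff {V : Type*} [NormedAddCommGroup V] [NormedSpace ℝ V] {x : V}
    {f : V → W} (hf : ContDiffAt ℝ ∞ f x) : DifferentiableAt ℝ f x :=
  hf.differentiableAt (by simp)

theorem _root_.ContDiffAt.smul_diff {V : Type*} [NormedAddCommGroup V] [NormedSpace ℝ V] {x : V}
    {c : V → ℝ} {f : V → W} (hc : ContDiffAt ℝ ∞ c x) (hf : ContDiffAt ℝ ∞ f x) :
    DifferentiableAt ℝ (fun z => c z • f z) x :=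
  (hc.smul hf).diff

theorem pderiv_congr {f g : EuclideanSpace ℝ (Fin m) → W} (h : f =ᶠ[𝓝 y] g) (i : Fin m) :
    pderiv i f y = pderiv i g y := by
  rw [pderiv, pderiv, h.fderiv_eq]

theorem pderiv_add {f g : EuclideanSpace ℝ (Fin m) → W} (hf : DifferentiableAt ℝ f y)
    (hg : DifferentiableAt ℝ g y) (i : Fin m) :
    pderiv i (fun z => f z + g z) y = pderiv i f y + pderiv i g y := by
  rw [pderiv, fderiv_fun_add hf hg]; rfl

theorem pderiv_sum {κ : Type*} (s : Finset κ) {f : κ → EuclideanSpace ℝ (Fin m) → W}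
    (hf : ∀ k ∈ s, DifferentiableAt ℝ (f k) y) (i : Fin m) :
    pderiv i (fun z => ∑ k ∈ s, f k z) y = ∑ k ∈ s, pderiv i (f k) y := by
  rw [pderiv, fderiv_fun_sum hf, sum_apply]; rfl

theorem pderiv_smul {c : EuclideanSpace ℝ (Fin m) → ℝ} {f : EuclideanSpace ℝ (Fin m) → W}
    (hc : DifferentiableAt ℝ c y) (hf : DifferentiableAt ℝ f y) (i : Fin m) :
    pderiv i (fun z => c z • f z) y = c y • pderiv i f y + pderiv i c y • f y := by
  rw [pderiv, fderiv_fun_smul hc hf]; rfl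

theorem pderiv_inner {F : Type*} [NormedAddCommGroup F] [InnerProductSpace ℝ F]
    {f g : EuclideanSpace ℝ (Fin m) → F} (hf : DifferentiableAt ℝ f y)
    (hg : DifferentiableAt ℝ g y) (i : Fin m) :
    pderiv i (fun z => (inner ℝ (f z) (g z) : ℝ)) y
      = inner ℝ (f y) (pderiv i g y) + inner ℝ (pderiv i f y) (g y) := by
  rw [pderiv, fderiv_inner_apply ℝ hf hg]; rfl

theorem pderiv_const (c : W) (i : Fin m) : pderiv i (fun _ => c) y = 0 := by
  simp [pderiv]

theorem pderiv_comp {V : Type*} [NormedAddCommGroup V] [NormedSpace ℝ V] {f : V → W}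
    {X : EuclideanSpace ℝ (Fin m) → V} (hf : DifferentiableAt ℝ f (X y))
    (hX : DifferentiableAt ℝ X y) (i : Fin m) :
    pderiv i (fun z => f (X z)) y = fderiv ℝ f (X y) (pderiv i X y) := by
  rw [pderiv, fderiv_fun_comp y hf hX]; rfl

/-- The derivative of `z ↦ (φ z) (f z)` for a field `φ` of continuous linear maps. -/
theorem pderiv_clm_apply {V : Type*} [NormedAddCommGroup V] [NormedSpace ℝ V]
    {φ : EuclideanSpace ℝ (Fin m) → V →L[ℝ] W} {f : EuclideanSpace ℝ (Fin m) → V}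
    (hφ : DifferentiableAt ℝ φ y) (hf : DifferentiableAt ℝ f y) (i : Fin m) :
    pderiv i (fun z => φ z (f z)) y = φ y (pderiv i f y) + pderiv i φ y (f y) := by
  rw [pderiv, fderiv_clm_apply hφ hf]; rfl

theorem pderiv_pderiv_eq {f : EuclideanSpace ℝ (Fin m) → W} (hf : ContDiffAt ℝ ∞ f y)
    (i j : Fin m) : pderiv i (pderiv j f) y = fderiv ℝ (fderiv ℝ f) y (EuclideanSpace.single i 1)
      (EuclideanSpace.single j 1) := by
  have h : pderiv i (fun z => fderiv ℝ f z (EuclideanSpace.single j 1)) y = _ :=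
    pderiv_clm_apply (hf.fderiv_right (m := ∞) le_rfl).diff (differentiableAt_const _) i
  rw [show pderiv j f = fun z => fderiv ℝ f z (EuclideanSpace.single j 1) from rfl, h,
    pderiv_const]
  simp [pderiv]

theorem pderiv_comm {f : EuclideanSpace ℝ (Fin m) → W} (hf : ContDiffAt ℝ ∞ f y)
    (i j : Fin m) : pderiv i (pderiv j f) y = pderiv j (pderiv i f) y := by
  rw [pderiv_pderiv_eq hf, pderiv_pderiv_eq hf]
  exact hf.isSymmSndFDerivAt (by
    rw [minSmoothness_of_isRCLikeNormedField]
    exact WithTop.coe_le_coe.mpr (le_top : (2 : ℕ∞) ≤ ⊤)) _ _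

/-- Cramer's rule: each entry of the inverse is a quotient of determinants, which are polynomials in
the entries. -/
theorem _root_.ContDiffAt.matrix_inv {κ : Type*} [Fintype κ] [DecidableEq κ]
    {V : Type*} [NormedAddCommGroup V] [NormedSpace ℝ V] {x : V}
    {A : V → Matrix κ κ ℝ} (hA : ∀ i j, ContDiffAt ℝ ∞ (fun z => A z i j) x)
    (hdet : (A x).det ≠ 0) (i j : κ) : ContDiffAt ℝ ∞ (fun z => (A z)⁻¹ i j) x := by
  have hd : ∀ B : V → Matrix κ κ ℝ, (∀ i j, ContDiffAt ℝ ∞ (fun z => B z i j) x) →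
      ContDiffAt ℝ ∞ (fun z => (B z).det) x := by
    intro B hB
    simp only [Matrix.det_apply']
    exact ContDiffAt.sum fun σ _ => contDiffAt_const.mul (contDiffAt_prod fun k _ => hB _ _)
  simp only [Matrix.inv_def, Matrix.smul_apply, smul_eq_mul, Ring.inverse_eq_inv',
    Matrix.adjugate_apply]
  refine ((hd A hA).inv hdet).mul (hd _ fun k l => ?_)
  -- Row `j` has been replaced by a constant basis vector; the other rows are those of `A`.
  by_cases h : k = j
  · subst h; simpa using contDiffAt_const
  · simpa [Matrix.updateRow_ne h] using hA k l

end PDeriv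

/-! ### Parametrized hypersurfaces -/

section Patch

open Topology

instance finrank_euclideanSpace_fact (n : ℕ) :
    Fact (Module.finrank ℝ (EuclideanSpace ℝ (Fin (n + 1))) = n + 1) :=
  ⟨by simp⟩

/-- The coordinate frame `∂ᵢX` of a parametrization `X`. -/
def frame {n : ℕ} (X : EuclideanSpace ℝ (Fin n) → EuclideanSpace ℝ (Fin (n + 1)))
    (y : EuclideanSpace ℝ (Fin n)) (i : Fin n) : EuclideanSpace ℝ (Fin (n + 1)) :=
  pderiv i X y

/-- The first fundamental form of a parametrization `X`. -/
def metric {n : ℕ} (X : EuclideanSpace ℝ (Fin n) → EuclideanSpace ℝ (Fin (n + 1)))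
    (y : EuclideanSpace ℝ (Fin n)) : Matrix (Fin n) (Fin n) ℝ :=
  Matrix.gram ℝ (frame X y)

/-- The second fundamental form of a parametrization `X` with normal field `N`. -/
def sff {n : ℕ} (X : EuclideanSpace ℝ (Fin n) → EuclideanSpace ℝ (Fin (n + 1)))
    (N : EuclideanSpace ℝ (Fin (n + 1)) → EuclideanSpace ℝ (Fin (n + 1)))
    (i j : Fin n) (y : EuclideanSpace ℝ (Fin n)) : ℝ :=
  inner ℝ (N (X y)) (pderiv i (pderiv j X) y)

/-- The matrix `sⁱⱼ = gⁱᵏ hₖⱼ` of the shape operator of a parametrization. -/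
def shape {n : ℕ} (X : EuclideanSpace ℝ (Fin n) → EuclideanSpace ℝ (Fin (n + 1)))
    (N : EuclideanSpace ℝ (Fin (n + 1)) → EuclideanSpace ℝ (Fin (n + 1)))
    (i j : Fin n) (y : EuclideanSpace ℝ (Fin n)) : ℝ :=
  ∑ k, (metric X y)⁻¹ i k * sff X N k j y

/-- `X` is a regular smooth parametrization on the open set `W` of a hypersurface with
unit normal field `N`. -/
structure IsPatch {n : ℕ} (X : EuclideanSpace ℝ (Fin n) → EuclideanSpace ℝ (Fin (n + 1)))
    (N : EuclideanSpace ℝ (Fin (n + 1)) → EuclideanSpace ℝ (Fin (n + 1)))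
    (W : Set (EuclideanSpace ℝ (Fin n))) : Prop where
  isOpen : IsOpen W
  smooth : ∀ y ∈ W, ContDiffAt ℝ ∞ X y
  smooth_normal : ∀ y ∈ W, ContDiffAt ℝ ∞ N (X y)
  linearIndependent : ∀ y ∈ W, LinearIndependent ℝ (frame X y)
  unit : ∀ y ∈ W, ‖N (X y)‖ = 1
  normal : ∀ y ∈ W, ∀ i, inner ℝ (N (X y)) (frame X y i) = 0

namespace IsPatch

variable {n : ℕ} {X : EuclideanSpace ℝ (Fin n) → EuclideanSpace ℝ (Fin (n + 1))}
  {N : EuclideanSpace ℝ (Fin (n + 1)) → EuclideanSpace ℝ (Fin (n + 1))}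
  {W : Set (EuclideanSpace ℝ (Fin n))} {y : EuclideanSpace ℝ (Fin n)}

theorem eventually (P : IsPatch X N W) (hy : y ∈ W) {p : EuclideanSpace ℝ (Fin n) → Prop}
    (h : ∀ z ∈ W, p z) : ∀ᶠ z in 𝓝 y, p z :=
  Filter.mem_of_superset (P.isOpen.mem_nhds hy) h

theorem smooth_frame (P : IsPatch X N W) (hy : y ∈ W) (i : Fin n) :
    ContDiffAt ℝ ∞ (fun z => frame X z i) y :=
  (P.smooth y hy).pderiv i

theorem smooth_normal_comp (P : IsPatch X N W) (hy : y ∈ W) :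
    ContDiffAt ℝ ∞ (fun z => N (X z)) y :=
  (P.smooth_normal y hy).comp y (P.smooth y hy)

theorem smooth_metric (P : IsPatch X N W) (hy : y ∈ W) (i j : Fin n) :
    ContDiffAt ℝ ∞ (fun z => metric X z i j) y :=
  (P.smooth_frame hy i).inner ℝ (P.smooth_frame hy j)

theorem smooth_metric_inv (P : IsPatch X N W) (hy : y ∈ W) (i j : Fin n) :
    ContDiffAt ℝ ∞ (fun z => (metric X z)⁻¹ i j) y :=
  ContDiffAt.matrix_inv (fun i j => P.smooth_metric hy i j)
    (isUnit_det_gram (P.linearIndependent y hy)).ne_zero i j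

theorem smooth_christoffel (P : IsPatch X N W) (hy : y ∈ W) (k i j : Fin n) :
    ContDiffAt ℝ ∞ (christoffel (metric X) k i j) y :=
  contDiffAt_const.mul (ContDiffAt.sum fun l _ => (P.smooth_metric_inv hy k l).mul
    ((((P.smooth_metric hy j l).pderiv i).add ((P.smooth_metric hy i l).pderiv j)).sub
      ((P.smooth_metric hy i j).pderiv l)))

theorem smooth_sff (P : IsPatch X N W) (hy : y ∈ W) (i j : Fin n) :
    ContDiffAt ℝ ∞ (sff X N i j) y :=
  (P.smooth_normal_comp hy).inner ℝ ((P.smooth_frame hy j).pderiv i)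

theorem smooth_dualFrame (P : IsPatch X N W) (hy : y ∈ W) (i : Fin n) :
    ContDiffAt ℝ ∞ (fun z => dualFrame (frame X z) i) y :=
  ContDiffAt.sum fun j _ => (P.smooth_metric_inv hy i j).smul (P.smooth_frame hy j)

theorem sff_symm (P : IsPatch X N W) (hy : y ∈ W) (i j : Fin n) :
    sff X N i j y = sff X N j i y := by
  rw [sff, sff, pderiv_comm (P.smooth y hy)]

/-! ### Gauss and Weingarten equations, curvature of the induced metric. -/

theorem pderiv_metric (P : IsPatch X N W) (hy : y ∈ W) (i j l : Fin n) :
    pderiv i (fun z => metric X z j l) y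
      = inner ℝ (frame X y j) (pderiv i (pderiv l X) y)
        + inner ℝ (pderiv i (pderiv j X) y) (frame X y l) :=
  pderiv_inner (P.smooth_frame hy j).diff (P.smooth_frame hy l).diff i

/-- The product rule turns the three metric derivatives into six inner products. Since second
partials of `X` commute, four cancel and the other two are equal, absorbing the factor 1/2. -/
theorem christoffel_eq (P : IsPatch X N W) (hy : y ∈ W) (k i j : Fin n) :
    christoffel (metric X) k i j y
      = inner ℝ (dualFrame (frame X y) k) (pderiv i (pderiv j X) y) := by
  rw [christoffel, inner_dualFrame, Finset.mul_sum]
  refine Finset.sum_congr rfl fun l _ => ?_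
  rw [P.pderiv_metric hy, P.pderiv_metric hy, P.pderiv_metric hy, metric,
    pderiv_comm (P.smooth y hy) j i, pderiv_comm (P.smooth y hy) l j,
    pderiv_comm (P.smooth y hy) l i,
    real_inner_comm (frame X y j), real_inner_comm (frame X y l)]
  ring

theorem eq_sum (P : IsPatch X N W) (hy : y ∈ W) (u : EuclideanSpace ℝ (Fin (n + 1))) :
    u = ∑ i, (inner ℝ (dualFrame (frame X y) i) u : ℝ) • frame X y i
      + (inner ℝ (N (X y)) u : ℝ) • N (X y) :=
  eq_sum_dualFrame (P.linearIndependent y hy) (P.unit y hy) (P.normal y hy) u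

/-- The Gauss formula. -/
theorem gauss_formula (P : IsPatch X N W) (hy : y ∈ W) (i j : Fin n) :
    pderiv i (pderiv j X) y
      = ∑ k, christoffel (metric X) k i j y • frame X y k + sff X N i j y • N (X y) := by
  simp only [P.christoffel_eq hy]
  exact P.eq_sum hy _

/-- The Weingarten equation. -/
theorem inner_dualFrame_pderiv_normal (P : IsPatch X N W) (hy : y ∈ W) (l i : Fin n) :
    inner ℝ (dualFrame (frame X y) l) (pderiv i (fun z => N (X z)) y) = -shape X N l i y := by
  rw [inner_dualFrame, shape, ← Finset.sum_neg_distrib]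
  refine Finset.sum_congr rfl fun k _ => ?_
  -- Orthogonality holds on a neighborhood, so it may be differentiated.
  have h0 : (fun z => (inner ℝ (N (X z)) (frame X z k) : ℝ)) =ᶠ[𝓝 y] fun _ => 0 :=
    P.eventually hy fun z hz => P.normal z hz k
  have h := pderiv_congr h0 i
  rw [pderiv_inner (P.smooth_normal_comp hy).diff (P.smooth_frame hy k).diff, pderiv_const] at h
  have h' : sff X N i k y + inner ℝ (pderiv i (fun z => N (X z)) y) (frame X y k) = 0 := h
  rw [P.sff_symm hy k i, metric, real_inner_comm]
  linear_combination (Matrix.gram ℝ (frame X y))⁻¹ l k * h'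

/-- Differentiate the Gauss formula for ∂ⱼ∂ₖX along ∂ᵢ. Its normal term has a tangential
contribution only through the derivative of `N`, given by Weingarten. Antisymmetrizing in `i`, `j`
will produce the Gauss equation. -/
theorem inner_dualFrame_third (P : IsPatch X N W) (hy : y ∈ W) (l i j k : Fin n) :
    inner ℝ (dualFrame (frame X y) l) (pderiv i (pderiv j (pderiv k X)) y)
      = pderiv i (christoffel (metric X) l j k) y
        + ∑ m, christoffel (metric X) m j k y * christoffel (metric X) l i m y
        - sff X N j k y * shape X N l i y := by
  have h0 : pderiv j (pderiv k X) =ᶠ[𝓝 y] fun z =>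
      ∑ m, christoffel (metric X) m j k z • frame X z m + sff X N j k z • N (X z) :=
    P.eventually hy fun z hz => P.gauss_formula hz j k
  have hs : ∀ m, DifferentiableAt ℝ (fun z => christoffel (metric X) m j k z • frame X z m) y :=
    fun m => (P.smooth_christoffel hy m j k).smul_diff (P.smooth_frame hy m)
  rw [pderiv_congr h0, pderiv_add (DifferentiableAt.fun_sum fun m _ => hs m)
    ((P.smooth_sff hy j k).smul_diff (P.smooth_normal_comp hy)),
    pderiv_sum _ (fun m _ => hs m), pderiv_smul (P.smooth_sff hy j k).diff
    (P.smooth_normal_comp hy).diff]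
  simp only [pderiv_smul (P.smooth_christoffel hy _ j k).diff (P.smooth_frame hy _).diff,
    Finset.sum_add_distrib, inner_add_right, inner_dualFrame_sum (P.linearIndependent y hy),
    real_inner_smul_right, P.inner_dualFrame_pderiv_normal hy,
    inner_dualFrame_normal (P.normal y hy), inner_sum]
  have hc : ∀ m, inner ℝ (dualFrame (frame X y) l) (pderiv i (fun z => frame X z m) y)
      = christoffel (metric X) l i m y := fun m => (P.christoffel_eq hy l i m).symm
  simp only [hc]
  ring

/-- The Gauss equation. -/
theorem curvatureCoord_eq (P : IsPatch X N W) (hy : y ∈ W) (i j k l : Fin n) :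
    curvatureCoord (metric X) i j k l y
      = sff X N j k y * shape X N l i y - sff X N i k y * shape X N l j y := by
  have h1 := P.inner_dualFrame_third hy l i j k
  have h2 := P.inner_dualFrame_third hy l j i k
  -- Both expansions now concern the same third derivative of `X`; their difference is the Gauss
  -- equation.
  rw [pderiv_comm ((P.smooth y hy).pderiv k) j i] at h2
  rw [curvatureCoord, Finset.sum_sub_distrib]
  linarith

theorem sum_metric_inv_mul_sff (P : IsPatch X N W) (hy : y ∈ W) (i j : Fin n) :
    ∑ k, (metric X y)⁻¹ i k * sff X N j k y = shape X N i j y :=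
  Finset.sum_congr rfl fun k _ => by rw [P.sff_symm hy]

/-- Contraction of the Gauss equation: Ric = (tr s) s - s² as an endomorphism. -/
theorem ricciVecCoord_eq (P : IsPatch X N W) (hy : y ∈ W)
    (w : EuclideanSpace ℝ (Fin n) → EuclideanSpace ℝ (Fin n)) (j : Fin n) :
    ricciVecCoord (metric X) w y j
      = (∑ i, shape X N i i y) * ∑ m, shape X N j m y * w y m
        - ∑ i, shape X N j i y * ∑ m, shape X N i m y * w y m := by
  have hR : ∀ m k, ricciCoord (metric X) m k y
      = sff X N m k y * (∑ i, shape X N i i y) - ∑ i, sff X N i k y * shape X N i m y := by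
    intro m k
    simp only [ricciCoord, P.curvatureCoord_eq hy, Finset.sum_sub_distrib, Finset.mul_sum]
  have h1 : ∀ m, ∑ k, (metric X y)⁻¹ j k * ricciCoord (metric X) m k y
      = shape X N j m y * (∑ i, shape X N i i y) - ∑ i, shape X N j i y * shape X N i m y := by
    intro m
    simp only [hR, mul_sub, Finset.sum_sub_distrib, ← P.sum_metric_inv_mul_sff hy j,
      Finset.sum_mul, ← mul_assoc, Finset.mul_sum]
    congr 1 <;> exact Finset.sum_comm
  have h2 : ricciVecCoord (metric X) w y j
      = ∑ m, (∑ k, (metric X y)⁻¹ j k * ricciCoord (metric X) m k y) * w y m := by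
    simp only [ricciVecCoord, Finset.mul_sum, Finset.sum_mul, mul_assoc]
    exact Finset.sum_comm
  rw [h2]
  simp only [h1, sub_mul, Finset.sum_sub_distrib]
  congr 1
  · rw [Finset.mul_sum]
    exact Finset.sum_congr rfl fun m _ => by ring
  · simp only [Finset.mul_sum, Finset.sum_mul]
    rw [Finset.sum_comm]
    simp only [mul_assoc]

/-! ### First and second derivatives of a tangential field. -/

variable {v : EuclideanSpace ℝ (Fin (n + 1)) → EuclideanSpace ℝ (Fin (n + 1))}
  {w : EuclideanSpace ℝ (Fin n) → EuclideanSpace ℝ (Fin n)}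

/-- The components are pairings of the smooth dual frame with `v` along `X`, so they inherit the
smoothness of the extension. -/
theorem smooth_components (P : IsPatch X N W) (hy : y ∈ W) (hv : ∀ z ∈ W, ContDiffAt ℝ ∞ v (X z))
    (hw : ∀ z ∈ W, v (X z) = ∑ j, w z j • frame X z j) (j : Fin n) :
    ContDiffAt ℝ ∞ (fun z => w z j) y := by
  have h : ContDiffAt ℝ ∞ (fun z => (inner ℝ (dualFrame (frame X z) j) (v (X z)) : ℝ)) y :=
    (P.smooth_dualFrame hy j).inner ℝ ((hv y hy).comp y (P.smooth y hy))
  refine h.congr_of_eventuallyEq (P.eventually hy fun z hz => ?_)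
  simp only [hw z hz, inner_dualFrame_sum (P.linearIndependent z hz)]

theorem smooth_nablaCoord (P : IsPatch X N W) (hy : y ∈ W)
    (hv : ∀ z ∈ W, ContDiffAt ℝ ∞ v (X z))
    (hw : ∀ z ∈ W, v (X z) = ∑ j, w z j • frame X z j) (i j : Fin n) :
    ContDiffAt ℝ ∞ (nablaCoord (metric X) w i j) y :=
  ((P.smooth_components hy hv hw j).pderiv i).add (ContDiffAt.sum fun k _ =>
    (P.smooth_christoffel hy j i k).mul (P.smooth_components hy hv hw k))

/-- The Gauss formula for a tangential vector field. -/
theorem fderiv_frame (P : IsPatch X N W) (hy : y ∈ W) (hv : ∀ z ∈ W, ContDiffAt ℝ ∞ v (X z))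
    (hw : ∀ z ∈ W, v (X z) = ∑ j, w z j • frame X z j) (i : Fin n) :
    fderiv ℝ v (X y) (frame X y i)
      = ∑ j, nablaCoord (metric X) w i j y • frame X y j
        + (∑ k, sff X N i k y * w y k) • N (X y) := by
  have h0 : (fun z => v (X z)) =ᶠ[𝓝 y] fun z => ∑ j, w z j • frame X z j :=
    P.eventually hy hw
  have hs := fun j => P.smooth_components hy hv hw j
  rw [frame, ← pderiv_comp (hv y hy).diff (P.smooth y hy).diff, pderiv_congr h0,
    pderiv_sum _ fun j _ => (hs j).smul_diff (P.smooth_frame hy j)]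
  have h1 : ∀ j, pderiv i (fun z => w z j • frame X z j) y
      = w y j • (∑ k, christoffel (metric X) k i j y • frame X y k + sff X N i j y • N (X y))
        + pderiv i (fun z => w z j) y • frame X y j := by
    intro j
    rw [pderiv_smul (hs j).diff (P.smooth_frame hy j).diff, ← P.gauss_formula hy]
    rfl
  simp only [h1, nablaCoord, add_smul, Finset.sum_add_distrib, smul_add, Finset.sum_smul,
    Finset.smul_sum, smul_smul]
  rw [Finset.sum_comm]
  simp only [mul_comm (w y _)]
  abel

theorem inner_dualFrame_fderiv_frame (P : IsPatch X N W) (hy : y ∈ W)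
    (hv : ∀ z ∈ W, ContDiffAt ℝ ∞ v (X z))
    (hw : ∀ z ∈ W, v (X z) = ∑ j, w z j • frame X z j) (i j : Fin n) :
    inner ℝ (dualFrame (frame X y) j) (fderiv ℝ v (X y) (frame X y i))
      = nablaCoord (metric X) w i j y := by
  rw [P.fderiv_frame hy hv hw, inner_add_right, inner_dualFrame_sum (P.linearIndependent y hy),
    real_inner_smul_right, inner_dualFrame_normal (P.normal y hy), mul_zero, add_zero]

/-- Obtained by differentiating the Gauss formula for `v` along ∂ₖX. The Christoffel terms complete
∇ₖ∇ᵢ; the two correction terms come from the normal part of ∂ₖ∂ᵢX and from the derivative of `N`. -/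
theorem inner_dualFrame_hessian (P : IsPatch X N W) (hy : y ∈ W)
    (hv : ∀ z ∈ W, ContDiffAt ℝ ∞ v (X z))
    (hw : ∀ z ∈ W, v (X z) = ∑ j, w z j • frame X z j) (k i j : Fin n) :
    inner ℝ (dualFrame (frame X y) j)
        (fderiv ℝ (fderiv ℝ v) (X y) (frame X y k) (frame X y i))
      = nablaNablaCoord (metric X) w k i j y
        - sff X N k i y * inner ℝ (dualFrame (frame X y) j) (fderiv ℝ v (X y) (N (X y)))
        - shape X N j k y * ∑ l, sff X N i l y * w y l := by
  have hdv : ContDiffAt ℝ ∞ (fderiv ℝ v) (X y) := (hv y hy).fderiv_right (m := ∞) le_rfl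
  have h0 : (fun z => fderiv ℝ v (X z) (frame X z i)) =ᶠ[𝓝 y] fun z =>
      ∑ l, nablaCoord (metric X) w i l z • frame X z l
        + (∑ l, sff X N i l z * w z l) • N (X z) :=
    P.eventually hy fun z hz => P.fderiv_frame hz hv hw i
  have hs : ∀ l, DifferentiableAt ℝ
      (fun z => nablaCoord (metric X) w i l z • frame X z l) y :=
    fun l => (P.smooth_nablaCoord hy hv hw i l).smul_diff (P.smooth_frame hy l)
  have hb : ContDiffAt ℝ ∞ (fun z => ∑ l, sff X N i l z * w z l) y :=
    ContDiffAt.sum fun l _ => (P.smooth_sff hy i l).mul (P.smooth_components hy hv hw l)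
  have hl : pderiv k (fun z => fderiv ℝ v (X z) (frame X z i)) y
      = fderiv ℝ v (X y) (pderiv k (pderiv i X) y)
        + fderiv ℝ (fderiv ℝ v) (X y) (frame X y k) (frame X y i) := by
    have hφ : DifferentiableAt ℝ (fun z => fderiv ℝ v (X z)) y :=
      (hdv.comp y (P.smooth y hy)).diff
    rw [pderiv_clm_apply hφ (P.smooth_frame hy i).diff,
      pderiv_comp hdv.diff (P.smooth y hy).diff]
    rfl
  have hr := pderiv_congr h0 k
  rw [hl, pderiv_add (DifferentiableAt.fun_sum fun l _ => hs l)
    (hb.smul_diff (P.smooth_normal_comp hy)), pderiv_sum _ (fun l _ => hs l),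
    pderiv_smul hb.diff (P.smooth_normal_comp hy).diff] at hr
  replace hr := congrArg (inner ℝ (dualFrame (frame X y) j)) hr
  have hc : ∀ m, inner ℝ (dualFrame (frame X y) j) (pderiv k (fun z => frame X z m) y)
      = christoffel (metric X) j k m y := fun m => (P.christoffel_eq hy j k m).symm
  -- The chain rule left the first derivative of `v` applied to ∂ₖ∂ᵢX. Splitting that vector gives
  -- the term -Γˡₖᵢ ∇ₗvʲ of the second covariant derivative and the term in hₖᵢ.
  rw [P.gauss_formula hy] at hr
  simp only [pderiv_smul (P.smooth_nablaCoord hy hv hw i _).diff (P.smooth_frame hy _).diff,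
    Finset.sum_add_distrib, inner_add_right, inner_dualFrame_sum (P.linearIndependent y hy),
    real_inner_smul_right, P.inner_dualFrame_pderiv_normal hy, map_add, map_sum, map_smul,
    inner_dualFrame_normal (P.normal y hy), inner_sum, hc,
    P.inner_dualFrame_fderiv_frame hy hv hw] at hr
  have hcomm : ∑ l, nablaCoord (metric X) w i l y * christoffel (metric X) j k l y
      = ∑ l, christoffel (metric X) j k l y * nablaCoord (metric X) w i l y :=
    Finset.sum_congr rfl fun _ _ => mul_comm _ _
  rw [nablaNablaCoord]
  linarith

/-- The comparison of the Bochner Laplacians, in components. -/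
theorem inner_dualFrame_euclideanBochner (P : IsPatch X N W) (hy : y ∈ W)
    (hv : ∀ z ∈ W, ContDiffAt ℝ ∞ v (X z))
    (hw : ∀ z ∈ W, v (X z) = ∑ j, w z j • frame X z j) (j : Fin n) :
    inner ℝ (dualFrame (frame X y) j) (euclideanBochner v (X y))
      = bochnerCoord (metric X) w y j - ricciVecCoord (metric X) w y j
        + (∑ i, shape X N i i y)
          * inner ℝ (dualFrame (frame X y) j) (VectorField.lieBracket ℝ N v (X y))
        - inner ℝ (dualFrame (frame X y) j) (euclideanCov N (euclideanCov N v) (X y))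
        + inner ℝ (dualFrame (frame X y) j) (euclideanCov (euclideanCov N N) v (X y)) := by
  have hdv : ContDiffAt ℝ ∞ (fderiv ℝ v) (X y) := (hv y hy).fderiv_right (m := ∞) le_rfl
  have hNN : euclideanCov N (euclideanCov N v) (X y)
      = fderiv ℝ v (X y) (fderiv ℝ N (X y) (N (X y)))
        + fderiv ℝ (fderiv ℝ v) (X y) (N (X y)) (N (X y)) := by
    change fderiv ℝ (fun x => fderiv ℝ v x (N x)) (X y) (N (X y)) = _
    rw [fderiv_clm_apply hdv.diff (P.smooth_normal y hy).diff]
    rfl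
  have hNv : inner ℝ (dualFrame (frame X y) j) (fderiv ℝ N (X y) (v (X y)))
      = -∑ m, shape X N j m y * w y m := by
    rw [hw y hy, map_sum, inner_sum, ← Finset.sum_neg_distrib]
    refine Finset.sum_congr rfl fun m _ => ?_
    rw [map_smul, real_inner_smul_right, frame,
      ← pderiv_comp (P.smooth_normal y hy).diff (P.smooth y hy).diff,
      P.inner_dualFrame_pderiv_normal hy]
    ring
  have hB : euclideanBochner v (X y)
      = -(∑ i, ∑ k, (metric X y)⁻¹ i k •
          fderiv ℝ (fderiv ℝ v) (X y) (frame X y k) (frame X y i)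
        + fderiv ℝ (fderiv ℝ v) (X y) (N (X y)) (N (X y))) := by
    rw [metric, ← sum_basis_eq_trace_frame (EuclideanSpace.basisFun _ ℝ)
      (P.linearIndependent y hy) (P.unit y hy) (P.normal y hy), euclideanBochner]
    simp only [pderiv_pderiv_eq (hv y hy), EuclideanSpace.basisFun_apply]
  have hsum : ∑ i, ∑ k, (metric X y)⁻¹ i k *
        (nablaNablaCoord (metric X) w k i j y
        - sff X N k i y * inner ℝ (dualFrame (frame X y) j) (fderiv ℝ v (X y) (N (X y)))
        - shape X N j k y * ∑ l, sff X N i l y * w y l)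
      = -bochnerCoord (metric X) w y j
        - (∑ i, shape X N i i y)
          * inner ℝ (dualFrame (frame X y) j) (fderiv ℝ v (X y) (N (X y)))
        - ∑ k, shape X N j k y * ∑ l, shape X N k l y * w y l := by
    -- Raising an index of h turns this trace into s² applied to `w`, the term matched by the s² in
    -- Ric.
    have hs2 : ∑ i, ∑ k, (metric X y)⁻¹ i k * (shape X N j k y * ∑ l, sff X N i l y * w y l)
        = ∑ k, shape X N j k y * ∑ l, shape X N k l y * w y l := by
      rw [Finset.sum_comm]
      refine Finset.sum_congr rfl fun k _ => ?_
      have hk : ∀ l, shape X N k l y = ∑ i, (metric X y)⁻¹ i k * sff X N i l y := fun l =>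
        Finset.sum_congr rfl fun i _ => by rw [metric, gram_inv_symm]
      simp only [hk, Finset.mul_sum, Finset.sum_mul]
      rw [Finset.sum_comm]
      exact Finset.sum_congr rfl fun l _ => Finset.sum_congr rfl fun i _ => by ring
    simp only [mul_sub, Finset.sum_sub_distrib, hs2]
    congr 2
    · simp [bochnerCoord]
    · simp only [shape, Finset.sum_mul, mul_assoc]
  rw [ricciVecCoord_eq P hy, hNN, hB, VectorField.lieBracket, euclideanCov, euclideanCov]
  simp only [inner_neg_right, inner_add_right, inner_sub_right, inner_sum, real_inner_smul_right,
    P.inner_dualFrame_hessian hy hv hw, hsum, hNv]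
  ring

end IsPatch

end Patch

/-! ### Charts of an immersed hypersurface -/

section Chart

open Topology

/-- The Christoffel correction is tangential, so pairing with `N` kills it. -/
theorem secondFundamentalForm_eq_sff {n : ℕ} {M : Type*} [TopologicalSpace M]
    {ι : M → EuclideanSpace ℝ (Fin (n + 1))}
    {e : OpenPartialHomeomorph M (EuclideanSpace ℝ (Fin n))}
    {N : EuclideanSpace ℝ (Fin (n + 1)) → EuclideanSpace ℝ (Fin (n + 1))}
    {W : Set (EuclideanSpace ℝ (Fin n))} (P : IsPatch (ι ∘ e.symm) N W)
    {p : M} (hp : p ∈ e.source) (hpW : e p ∈ W) (i j : Fin n) :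
    secondFundamentalForm ι e N p i j = sff (ι ∘ e.symm) N i j (e p) := by
  have hX : (ι ∘ e.symm) (e p) = ι p := congrArg ι (e.left_inv hp)
  have h := P.normal _ hpW
  rw [hX] at h
  rw [secondFundamentalForm, Matrix.of_apply, inner_sub_right, inner_sum, sff, hX]
  have h0 : ∀ k, inner ℝ (N (ι p)) (pderiv k (ι ∘ e.symm) (e p)) = (0 : ℝ) := h
  simp [real_inner_smul_right, h0]

theorem mul_meanCurvature_eq {n : ℕ} (hn : n ≠ 0) {M : Type*} [TopologicalSpace M]
    {ι : M → EuclideanSpace ℝ (Fin (n + 1))}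
    {e : OpenPartialHomeomorph M (EuclideanSpace ℝ (Fin n))}
    {N : EuclideanSpace ℝ (Fin (n + 1)) → EuclideanSpace ℝ (Fin (n + 1))}
    {W : Set (EuclideanSpace ℝ (Fin n))} (P : IsPatch (ι ∘ e.symm) N W)
    {p : M} (hp : p ∈ e.source) (hpW : e p ∈ W) :
    (n : ℝ) * meanCurvature ι e N p = ∑ i, shape (ι ∘ e.symm) N i i (e p) := by
  have hn' : (n : ℝ) ≠ 0 := Nat.cast_ne_zero.mpr hn
  rw [meanCurvature, ← mul_assoc, mul_one_div_cancel hn', one_mul, Matrix.trace]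
  refine Finset.sum_congr rfl fun i _ => ?_
  rw [Matrix.diag_apply, shapeOperator, Matrix.mul_apply]
  refine Finset.sum_congr rfl fun k _ => ?_
  rw [secondFundamentalForm_eq_sff P hp hpW]
  rfl

variable {n : ℕ} {M : Type*} [TopologicalSpace M] [ChartedSpace (EuclideanSpace ℝ (Fin n)) M]

/-- In the charts adapted to an immersion, `f` is an injective linear map `L`. Hence dψ ∘ df = L ∘
dφ with the right side injective, which forces df to be injective. -/
theorem _root_.Manifold.IsImmersionAt.mfderiv_injective {m : ℕ}
    {f : M → EuclideanSpace ℝ (Fin m)} {x : M}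
    (h : Manifold.IsImmersionAt (𝓡 n) (𝓡 m) ∞ f x) :
    Function.Injective (mfderiv (𝓡 n) (𝓡 m) f x) := by
  have hφ : MDifferentiableAt (𝓡 n) (𝓡 n) h.domChart x :=
    (contMDiffAt_of_mem_maximalAtlas h.domChart_mem_maximalAtlas
      h.mem_domChart_source).mdifferentiableAt (by simp)
  have hψ : MDifferentiableAt (𝓡 m) (𝓡 m) h.codChart (f x) :=
    (contMDiffAt_of_mem_maximalAtlas h.codChart_mem_maximalAtlas
      h.mem_codChart_source).mdifferentiableAt (by simp)
  have hf : MDifferentiableAt (𝓡 n) (𝓡 m) f x := h.contMDiffAt.mdifferentiableAt (by simp)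
  have hφ' : h.domChart.MDifferentiable (𝓡 n) (𝓡 n) :=
    ⟨(contMDiffOn_of_mem_maximalAtlas h.domChart_mem_maximalAtlas).mdifferentiableOn (by simp),
      (contMDiffOn_symm_of_mem_maximalAtlas
        h.domChart_mem_maximalAtlas).mdifferentiableOn (by simp)⟩
  set L : EuclideanSpace ℝ (Fin n) →L[ℝ] EuclideanSpace ℝ (Fin m) :=
    (h.equiv : (EuclideanSpace ℝ (Fin n) × h.complement) →L[ℝ] EuclideanSpace ℝ (Fin m)).comp
      (ContinuousLinearMap.inl ℝ _ _)
  have hL : Function.Injective L :=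
    h.equiv.injective.comp (fun a b hab => congrArg Prod.fst hab)
  have heq : (h.codChart ∘ f) =ᶠ[𝓝 x] (L ∘ h.domChart) := by
    filter_upwards [h.domChart.open_source.mem_nhds h.mem_domChart_source] with z hz
    have hz' : h.domChart z ∈ (h.domChart.extend (𝓡 n)).target := by
      simpa using h.domChart.map_source hz
    have := h.writtenInCharts hz'
    simpa [h.domChart.left_inv hz, L] using this
  have h1 := (hψ.hasMFDerivAt.comp x hf.hasMFDerivAt)
  have h2 := (L.hasMFDerivAt (x := h.domChart x)).comp x hφ.hasMFDerivAt
  have h3 := hasMFDerivAt_unique h1 (h2.congr_of_eventuallyEq heq)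
  intro a b hab
  refine hφ'.mfderiv_injective h.mem_domChart_source (hL ?_)
  have ha := DFunLike.congr_fun h3 a
  have hb := DFunLike.congr_fun h3 b
  refine ha.symm.trans (Eq.trans ?_ hb)
  exact congrArg (mfderiv (𝓡 m) (𝓡 m) h.codChart (f x)) hab

theorem sum_smul_frame (X : EuclideanSpace ℝ (Fin n) → EuclideanSpace ℝ (Fin (n + 1)))
    (y w : EuclideanSpace ℝ (Fin n)) : ∑ j, w j • frame X y j = fderiv ℝ X y w := by
  conv_rhs => rw [← (EuclideanSpace.basisFun (Fin n) ℝ).sum_repr w]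
  simp [frame, pderiv]

variable {ι : M → EuclideanSpace ℝ (Fin (n + 1))}
  {e : OpenPartialHomeomorph M (EuclideanSpace ℝ (Fin n))}

theorem mdifferentiable_of_mem_maximalAtlas (he : e ∈ IsManifold.maximalAtlas (𝓡 n) ∞ M) :
    e.MDifferentiable (𝓡 n) (𝓡 n) :=
  ⟨(contMDiffOn_of_mem_maximalAtlas he).mdifferentiableOn (by simp),
    (contMDiffOn_symm_of_mem_maximalAtlas he).mdifferentiableOn (by simp)⟩

theorem contDiffAt_comp_symm (hι : ContMDiff (𝓡 n) (𝓡 (n + 1)) ∞ ι)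
    (he : e ∈ IsManifold.maximalAtlas (𝓡 n) ∞ M) {y : EuclideanSpace ℝ (Fin n)}
    (hy : y ∈ e.target) : ContDiffAt ℝ ∞ (ι ∘ e.symm) y := by
  rw [← contMDiffAt_iff_contDiffAt]
  exact (hι _).comp y (contMDiffAt_symm_of_mem_maximalAtlas he hy)

theorem fderiv_comp_symm (hι : ContMDiff (𝓡 n) (𝓡 (n + 1)) ∞ ι)
    (he : e ∈ IsManifold.maximalAtlas (𝓡 n) ∞ M) {y : EuclideanSpace ℝ (Fin n)}
    (hy : y ∈ e.target) (u : EuclideanSpace ℝ (Fin n)) :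
    fderiv ℝ (ι ∘ e.symm) y u
      = pushforward ι (e.symm y) (mfderiv (𝓡 n) (𝓡 n) e.symm y u) := by
  rw [← mfderiv_eq_fderiv, mfderiv_comp y ((hι _).mdifferentiableAt (by simp))
    ((mdifferentiable_of_mem_maximalAtlas he).mdifferentiableAt_symm hy)]
  rfl

theorem sum_components_smul_frame (hι : ContMDiff (𝓡 n) (𝓡 (n + 1)) ∞ ι)
    (he : e ∈ IsManifold.maximalAtlas (𝓡 n) ∞ M) (V : ∀ x : M, TangentSpace (𝓡 n) x)
    {y : EuclideanSpace ℝ (Fin n)} (hy : y ∈ e.target) :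
    ∑ j, components e V y j • frame (ι ∘ e.symm) y j
      = pushforward ι (e.symm y) (V (e.symm y)) := by
  rw [sum_smul_frame, fderiv_comp_symm hι he hy]
  have h := (mdifferentiable_of_mem_maximalAtlas he).symm_comp_deriv (e.map_target hy)
  rw [e.right_inv hy] at h
  exact congrArg (pushforward ι (e.symm y)) (DFunLike.congr_fun h (V (e.symm y)))

theorem pushforward_ofComponents (hι : ContMDiff (𝓡 n) (𝓡 (n + 1)) ∞ ι)
    (he : e ∈ IsManifold.maximalAtlas (𝓡 n) ∞ M) {p : M} (hp : p ∈ e.source)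
    (w : EuclideanSpace ℝ (Fin n)) :
    pushforward ι p (ofComponents e p w) = ∑ j, w j • frame (ι ∘ e.symm) (e p) j := by
  rw [sum_smul_frame, fderiv_comp_symm hι he (e.map_source hp)]
  -- The base points `e.symm (e p)` and `p` are only propositionally equal, while both tangent
  -- spaces are definitionally the model space; hence the transport along a general `q = p`.
  have h : ∀ q : M, q = p → ∀ u : EuclideanSpace ℝ (Fin n),
      pushforward ι p u = pushforward ι q u := by rintro q rfl u; rfl
  exact h _ (e.left_inv hp) _

theorem linearIndependent_frame (hι : Manifold.IsImmersion (𝓡 n) (𝓡 (n + 1)) ∞ ι)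
    (he : e ∈ IsManifold.maximalAtlas (𝓡 n) ∞ M) {y : EuclideanSpace ℝ (Fin n)}
    (hy : y ∈ e.target) : LinearIndependent ℝ (frame (ι ∘ e.symm) y) := by
  rw [Fintype.linearIndependent_iff]
  intro c hc i
  have h := sum_smul_frame (ι ∘ e.symm) y (WithLp.toLp 2 c)
  rw [show ∑ j, (WithLp.toLp 2 c : EuclideanSpace ℝ (Fin n)) j • frame (ι ∘ e.symm) y j = 0
    from hc, fderiv_comp_symm hι.contMDiff he hy] at h
  have h1 : mfderiv (𝓡 n) (𝓡 n) e.symm y (WithLp.toLp 2 c) = 0 :=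
    (hι.isImmersionAt (e.symm y)).mfderiv_injective (h.symm.trans (map_zero _).symm)
  have h2 : (WithLp.toLp 2 c : EuclideanSpace ℝ (Fin n)) = 0 :=
    (mdifferentiable_of_mem_maximalAtlas he).symm.mfderiv_injective hy
      (h1.trans (map_zero _).symm)
  exact congrFun (congrArg WithLp.ofLp h2) i

/-- The chart domain is cut down to the points mapped into `U`, where `N` is known to be a smooth
unit normal. -/
theorem isPatch_comp_symm (hι : Manifold.IsImmersion (𝓡 n) (𝓡 (n + 1)) ∞ ι)
    (he : e ∈ IsManifold.maximalAtlas (𝓡 n) ∞ M)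
    {U : Set (EuclideanSpace ℝ (Fin (n + 1)))} (hU : IsOpen U)
    {N : EuclideanSpace ℝ (Fin (n + 1)) → EuclideanSpace ℝ (Fin (n + 1))}
    (hN : ContDiffOn ℝ ∞ N U)
    (hN_unit : ∀ x : M, ι x ∈ U → ‖N (ι x)‖ = 1)
    (hN_normal : ∀ x : M, ι x ∈ U → ∀ w : TangentSpace (𝓡 n) x,
      inner ℝ (N (ι x)) (pushforward ι x w) = 0) :
    IsPatch (ι ∘ e.symm) N (e.target ∩ (ι ∘ e.symm) ⁻¹' U) where
  isOpen := ContinuousOn.isOpen_inter_preimage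
    (hι.contMDiff.continuous.comp_continuousOn e.continuousOn_symm) e.open_target hU
  smooth y hy := contDiffAt_comp_symm hι.contMDiff he hy.1
  smooth_normal y hy := hN.contDiffAt (hU.mem_nhds hy.2)
  linearIndependent y hy := linearIndependent_frame hι he hy.1
  unit y hy := hN_unit _ hy.2
  normal y hy i := by
    rw [frame, pderiv, fderiv_comp_symm hι.contMDiff he hy.1]
    exact hN_normal _ hy.2 _

/-- In the adapted expansion of `w` the remainder is a multiple of `N`, orthogonal to the range of
dι; this characterizes the projection. -/
theorem tangentialPart_eq_sum {N : EuclideanSpace ℝ (Fin (n + 1)) → EuclideanSpace ℝ (Fin (n + 1))}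
    {W : Set (EuclideanSpace ℝ (Fin n))} (P : IsPatch (ι ∘ e.symm) N W)
    (hι : ContMDiff (𝓡 n) (𝓡 (n + 1)) ∞ ι)
    (he : e ∈ IsManifold.maximalAtlas (𝓡 n) ∞ M) {p : M} (hp : p ∈ e.source) (hpW : e p ∈ W)
    (hN_normal : ∀ w : TangentSpace (𝓡 n) p, inner ℝ (N (ι p)) (pushforward ι p w) = 0)
    (w : EuclideanSpace ℝ (Fin (n + 1))) :
    tangentialPart ι p w = ∑ j, (inner ℝ (dualFrame (frame (ι ∘ e.symm) (e p)) j) w : ℝ) •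
      frame (ι ∘ e.symm) (e p) j := by
  have hX : (ι ∘ e.symm) (e p) = ι p := congrArg ι (e.left_inv hp)
  have h := P.eq_sum hpW w
  rw [hX] at h
  refine Submodule.eq_starProjection_of_mem_orthogonal ?_ ?_
  · exact ⟨ofComponents e p (WithLp.toLp 2 fun j =>
      inner ℝ (dualFrame (frame (ι ∘ e.symm) (e p)) j) w),
      pushforward_ofComponents hι he hp _⟩
  · rw [sub_eq_of_eq_add' h]
    refine Submodule.smul_mem _ _ ?_
    rw [Submodule.mem_orthogonal']
    rintro _ ⟨u, rfl⟩
    exact hN_normal u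

end Chart

end Hypersurface

end

/-! ### Assembly: the componentwise identity in the chart `e`. -/

theorem theorem1p1 {n : ℕ} (hn : 2 ≤ n) {M : Type*} [TopologicalSpace M]
    [ChartedSpace (EuclideanSpace ℝ (Fin n)) M] [IsManifold (𝓡 n) ∞ M]
    (ι : M → EuclideanSpace ℝ (Fin (n + 1)))
    (hι : Manifold.IsSmoothEmbedding (𝓡 n) (𝓡 (n + 1)) ∞ ι)
    (V : ∀ x : M, TangentSpace (𝓡 n) x)
    (hV : ContMDiff (𝓡 n) (𝓡 n).tangent ∞ (fun x => (⟨x, V x⟩ : TangentBundle (𝓡 n) M)))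
    (p : M) (U : Set (EuclideanSpace ℝ (Fin (n + 1)))) (hU : IsOpen U) (hpU : ι p ∈ U)
    (v : EuclideanSpace ℝ (Fin (n + 1)) → EuclideanSpace ℝ (Fin (n + 1)))
    (hv : ContDiffOn ℝ ∞ v U)
    (hvV : ∀ x : M, ι x ∈ U → v (ι x) = Hypersurface.pushforward ι x (V x))
    (N : EuclideanSpace ℝ (Fin (n + 1)) → EuclideanSpace ℝ (Fin (n + 1)))
    (hN : ContDiffOn ℝ ∞ N U)
    (hN_unit : ∀ x : M, ι x ∈ U → ‖N (ι x)‖ = 1)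
    (hN_normal : ∀ x : M, ι x ∈ U → ∀ w : TangentSpace (𝓡 n) x,
      inner ℝ (N (ι x)) (Hypersurface.pushforward ι x w) = 0)
    (e : OpenPartialHomeomorph M (EuclideanSpace ℝ (Fin n)))
    (he : e ∈ IsManifold.maximalAtlas (𝓡 n) ∞ M) (hpe : p ∈ e.source) :
    Hypersurface.tangentialPart ι p (Hypersurface.euclideanBochner v (ι p)) =
      Hypersurface.pushforward ι p (Hypersurface.bochnerLaplacian ι e V p)
      - Hypersurface.pushforward ι p (Hypersurface.ricciVec ι e V p)
      + ((n : ℝ) * Hypersurface.meanCurvature ι e N p) •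
          Hypersurface.tangentialPart ι p (VectorField.lieBracket ℝ N v (ι p))
      - Hypersurface.tangentialPart ι p
          (Hypersurface.euclideanCov N (Hypersurface.euclideanCov N v) (ι p))
      + Hypersurface.tangentialPart ι p
          (Hypersurface.euclideanCov (Hypersurface.euclideanCov N N) v (ι p)) := by
  have P := Hypersurface.isPatch_comp_symm hι.isImmersion he hU hN hN_unit hN_normal
  have hX : (ι ∘ e.symm) (e p) = ι p := congrArg ι (e.left_inv hpe)
  have hpW : e p ∈ e.target ∩ (ι ∘ e.symm) ⁻¹' U :=
    ⟨e.map_source hpe, by rw [Set.mem_preimage, hX]; exact hpU⟩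
  have key := P.inner_dualFrame_euclideanBochner hpW
    (fun y hy => hv.contDiffAt (hU.mem_nhds hy.2))
    (fun y hy => (hvV _ hy.2).trans
      (Hypersurface.sum_components_smul_frame hι.contMDiff he V hy.1).symm)
  rw [hX] at key
  simp only [Hypersurface.tangentialPart_eq_sum P hι.contMDiff he hpe hpW (hN_normal p hpU),
    Hypersurface.mul_meanCurvature_eq (by omega) P hpe hpW]
  rw [Hypersurface.bochnerLaplacian, Hypersurface.ricciVec,
    Hypersurface.pushforward_ofComponents hι.contMDiff he hpe,
    Hypersurface.pushforward_ofComponents hι.contMDiff he hpe,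
    show Hypersurface.inducedMetric ι e = Hypersurface.metric (ι ∘ e.symm) from rfl]
  simp only [key, Finset.smul_sum, smul_smul, ← Finset.sum_sub_distrib, ← Finset.sum_add_distrib,
    ← sub_smul, ← add_smul]
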